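/- There is an absolute constant $C>0$ such that the following holds. Let $G=(V,E)$ be a finite simple graph with $n=|V|$, $m=|E|$ and linear-width $\ell$; here the linear-width of $G$ is the smallest integer $\ell$ for which the edges can be arranged in a linear order $e_1,\dots,e_m$ such that, for every $i\in\{1,\dots,m\}$, at most $\ell$ vertices are incident both with an edge in $\{e_1,\dots,e_{i-1}\}$ and with an edge in $\{e_i,\dots,e_m\}$. Let $q,\mu>0$ be real and let $0<\varepsilon\le 1$. For $S\subseteq E$ let $\kappa(S)$ be the number of connected components of $(V,S)$, and let $\pi$ be the random cluster distribution on the subsets of $E$, given by $\pi(S)\propto q^{\kappa(S)}\mu^{|S|}$. The single bond flip chain on the subsets of $E$ with transition matrix $P$ is defined as follows: at state $X_t$, pick $e\in E$ uniformly at random and let $S=X_t\oplus\{e\}$; set $X_{t+1}=S$ with probability $\frac12\min\{1,q^{\kappa(S)-\kappa(X_t)}\mu^{|S|-|X_t|}\}$, and $X_{t+1}=X_t$ with the remaining probability (if $E=\emptyset$, the chain stays at its only state). Then the mixing time $$\tau(\varepsilon)=\max_{H\subseteq E}\ \min\bigl\{t\in\mathbb{Z}_{\ge 0}:\ \tfrac12\sum_{H'\subseteq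 E}|P^t(H,H')-\pi(H')|\le\varepsilon\bigr\}$$ is finite and satisfies $$\tau(\varepsilon)\le C\,m^2\,\bar q^{\,\ell}\left(m+n|\log q|+m|\log\mu|+\log(1/\varepsilon)\right),\qquad \bar q=\max\{q,1/q\}.$$ -/

import Mathlib

/-! Mixing times of finite Markov chains. -/

namespace FiniteChain

variable {Ω : Type*} [Fintype Ω]

/-- Total variation distance of two probability vectors on a finite set. -/
noncomputable def tvDist (ν ν' : Ω → ℝ) : ℝ :=
  (1 / 2) * ∑ H, |ν H - ν' H|

/-- `t` is a time at which the chain with transition matrix `P`, started at `H`,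
is within total variation distance `ε` of `ρ`. -/
def IsCloseAt [DecidableEq Ω] (P : Matrix Ω Ω ℝ) (ρ : Ω → ℝ) (ε : ℝ) (H : Ω) (t : ℕ) : Prop :=
  tvDist (fun H' => (P ^ t) H H') ρ ≤ ε

/-- Mixing time from the initial state `H`: the least `t` with `‖P ^ t (H, ·) - ρ‖ ≤ ε`
(the junk value is `0` if there is no such `t`). -/
noncomputable def mixingTimeFrom [DecidableEq Ω] (P : Matrix Ω Ω ℝ) (ρ : Ω → ℝ) (ε : ℝ)
    (H : Ω) : ℕ :=
  sInf {t : ℕ | IsCloseAt P ρ ε H t}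

/-- Mixing time: the maximum over all initial states. -/
noncomputable def mixingTime [DecidableEq Ω] (P : Matrix Ω Ω ℝ) (ρ : Ω → ℝ) (ε : ℝ) : ℕ :=
  Finset.univ.sup (fun H => mixingTimeFrom P ρ ε H)

end FiniteChain

namespace SimpleGraph

variable {V : Type*} [Fintype V] [DecidableEq V] (G : SimpleGraph V) [DecidableRel G.Adj]

/-- The vertices that have an incident edge among `e_j`, `j < i`, and an incident edge among
`e_k`, `k ≥ i`, where `e_j = σ j`. -/
def dangerous (σ : Fin G.edgeFinset.card ≃ G.edgeSet) (i : Fin G.edgeFinset.card) : Set V :=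
  {v | ∃ j k, j < i ∧ i ≤ k ∧ v ∈ (σ j : Sym2 V) ∧ v ∈ (σ k : Sym2 V)}

/-- The linear-width: the least `ℓ` such that some linear order of the edges has at most `ℓ`
dangerous vertices at every position. -/
noncomputable def linearWidth : ℕ :=
  sInf {ℓ : ℕ | ∃ σ : Fin G.edgeFinset.card ≃ G.edgeSet, ∀ i, (G.dangerous σ i).ncard ≤ ℓ}

variable {G}

/-- The spanning subgraph `(V, S)` for a set `S` of edges of `G`. -/
def spanningOf (S : Finset G.edgeSet) : SimpleGraph V :=
  SimpleGraph.fromEdgeSet ((fun e : G.edgeSet => (e : Sym2 V)) '' (S : Set G.edgeSet))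

/-- `κ(S)`: the number of connected components of `(V, S)`. -/
noncomputable def kappa (S : Finset G.edgeSet) : ℕ :=
  Nat.card (spanningOf S).ConnectedComponent

/-- The weight `q ^ κ(S) * μ ^ |S|`. -/
noncomputable def rcWeight (q μ : ℝ) (S : Finset G.edgeSet) : ℝ :=
  q ^ kappa S * μ ^ S.card

variable (G)

/-- The random cluster distribution `RC(q, μ)` on the sets of edges of `G`. -/
noncomputable def rcDist (q μ : ℝ) (S : Finset G.edgeSet) : ℝ :=
  rcWeight q μ S / ∑ T : Finset G.edgeSet, rcWeight q μ T

/-- The probability that the single bond flip chain at `X` chooses the edge `e` (uniformly) and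
moves to `S = X ⊕ {e}`:
`(1 / m) * (1 / 2) * min {1, q ^ (κ(S) - κ(X)) * μ ^ (|S| - |X|)}`. -/
noncomputable def flipProb (q μ : ℝ) (X : Finset G.edgeSet) (e : G.edgeSet) : ℝ :=
  (1 / (G.edgeFinset.card : ℝ)) * ((1 / 2) *
    min 1 (q ^ ((kappa (symmDiff X {e}) : ℤ) - (kappa X : ℤ)) *
      μ ^ (((symmDiff X {e}).card : ℤ) - (X.card : ℤ))))

/-- The transition matrix of the single bond flip chain for `RC(q, μ)`: move from `X` to
`X ⊕ {e}` with probability `flipProb X e`, stay at `X` with the remaining probability.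
(Without edges, the chain stays at its only state.) -/
noncomputable def bondFlip (q μ : ℝ) : Matrix (Finset G.edgeSet) (Finset G.edgeSet) ℝ :=
  fun X Y =>
    (∑ e : G.edgeSet, if Y = symmDiff X {e} then G.flipProb q μ X e else 0) +
      (if Y = X then 1 - ∑ e : G.edgeSet, G.flipProb q μ X e else 0)

end SimpleGraph

/-!
The bound comes from canonical paths and a Poincaré inequality.

Fix an order of the edges that attains the linear-width `ℓ`. The path from `I` to `F` goes through
the edges in this order and replaces the status of each edge in `I` by its status in `F`: after the
edges in a prefix `T` it stands at `splice T F I`, which is `F` on `T` and `I` off `T`. The pair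
`(I, F)` is recovered from this state and the complementary state `splice T I F`, and both pairs
have the same total number of edges. Their total numbers of components differ by at most the number
of vertices incident both with `T` and with its complement (`kappa_add_kappa_le`), which is at most
`ℓ`, so that `π(I) π(F) ≤ q̄ ^ ℓ π(splice T F I) π(splice T I F)`. Summing over all pairs bounds
the load of each transition, and Cauchy–Schwarz along paths of length `m` gives a Poincaré
inequality with constant `4 m² q̄ ^ ℓ` (`pairVariance_le_dirichlet`).

The component bound is linear algebra: `κ(S)` is the dimension of the space of real functions on the
vertices that are constant on the edges in `S` (`kappa_eq_finrank`), and unions of edge sets become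
intersections of subspaces. On the functions that vanish on the boundary of `T`, a subspace of
codimension at most the size of the boundary, the edges in `T` and those off `T` act on disjoint
sets of vertices, so dimensions are modular there; elsewhere submodularity suffices.

The chain stays put with probability at least `1/2`, so one step lowers the squared `L²(π)` norm by
at least the Dirichlet form (`FiniteChain.sum_sq_mulVec_le`). Hence the `L²(π)` distance to
stationarity decays exponentially (`FiniteChain.isCloseAt_of_poincare`), starting from
`1 / π(H)`, whose logarithm is at most `m + n |log q| + m |log μ|` (`log_one_div_rcDist_le`).
-/

/-! ### Mixing of lazy reversible chains from a Poincaré inequality -/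

namespace FiniteChain

section Decay

variable {Ω : Type*} [Fintype Ω] {P : Matrix Ω Ω ℝ} {ρ : Ω → ℝ}

/-- The Dirichlet form `½ ∑ ρ(x) P(x,y) (f(x) - f(y))²` of a chain. -/
noncomputable def dirichlet (P : Matrix Ω Ω ℝ) (ρ : Ω → ℝ) (f : Ω → ℝ) : ℝ :=
  (1 / 2) * ∑ x, ∑ y, ρ x * P x y * (f x - f y) ^ 2

/-- The variance of `f` under `ρ`, in the form `½ ∑ ρ(x) ρ(y) (f(x) - f(y))²`. -/
noncomputable def pairVariance (ρ : Ω → ℝ) (f : Ω → ℝ) : ℝ :=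
  (1 / 2) * ∑ x, ∑ y, ρ x * ρ y * (f x - f y) ^ 2

theorem pairVariance_of_mean_zero (hρ1 : ∑ x, ρ x = 1) {f : Ω → ℝ} (hf : ∑ x, ρ x * f x = 0) :
    pairVariance ρ f = ∑ x, ρ x * f x ^ 2 := by
  have h : ∀ x y, ρ x * ρ y * (f x - f y) ^ 2 =
      (ρ x * f x ^ 2) * ρ y - 2 * ((ρ x * f x) * (ρ y * f y)) + ρ x * (ρ y * f y ^ 2) := by
    intro x y; ring
  unfold pairVariance
  simp only [h, Finset.sum_add_distrib, Finset.sum_sub_distrib, ← Finset.mul_sum,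
    ← Finset.sum_mul, hρ1, hf]
  ring

theorem sum_mul_mulVec_sub_self (hrow : ∀ x, ∑ y, P x y = 1)
    (hrev : ∀ x y, ρ x * P x y = ρ y * P y x) (f : Ω → ℝ) :
    ∑ x, ρ x * (f x * (P.mulVec f x - f x)) = -dirichlet P ρ f := by
  have h1 : ∀ x, ρ x * (f x * (P.mulVec f x - f x)) =
      ∑ y, ρ x * P x y * (f x * (f y - f x)) := by
    intro x
    have : P.mulVec f x - f x = ∑ y, P x y * (f y - f x) := by
      simp only [mul_sub, Finset.sum_sub_distrib, ← Finset.sum_mul, hrow, one_mul]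
      rfl
    rw [this, Finset.mul_sum, Finset.mul_sum]
    exact Finset.sum_congr rfl fun y _ => by ring
  have h2 : ∑ x, ∑ y, ρ x * P x y * (f x * (f y - f x)) =
      ∑ x, ∑ y, ρ x * P x y * (f y * (f x - f y)) := by
    rw [Finset.sum_comm]
    exact Finset.sum_congr rfl fun x _ => Finset.sum_congr rfl fun y _ => by rw [hrev y x]
  have h3 : ∑ x, ∑ y, ρ x * P x y * (f x * (f y - f x)) +
      ∑ x, ∑ y, ρ x * P x y * (f y * (f x - f y)) =
      -∑ x, ∑ y, ρ x * P x y * (f x - f y) ^ 2 := by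
    simp only [← Finset.sum_add_distrib, ← Finset.sum_neg_distrib]
    exact Finset.sum_congr rfl fun x _ => Finset.sum_congr rfl fun y _ => by ring
  simp only [h1, dirichlet]
  linarith

/-- The off-diagonal mass of a row is at most `1/2`, so Cauchy–Schwarz bounds the squared
increment of `f` by half of its expected squared change. -/
theorem sq_mulVec_sub_self_le [DecidableEq Ω] (hnn : ∀ x y, 0 ≤ P x y)
    (hrow : ∀ x, ∑ y, P x y = 1) (hlazy : ∀ x, 1 / 2 ≤ P x x) (f : Ω → ℝ) (x : Ω) :
    (P.mulVec f x - f x) ^ 2 ≤ (1 / 2) * ∑ y, P x y * (f x - f y) ^ 2 := by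
  have h1 : P.mulVec f x - f x = ∑ y ∈ Finset.univ.erase x, P x y * (f y - f x) := by
    have : P.mulVec f x - f x = ∑ y, P x y * (f y - f x) := by
      simp only [mul_sub, Finset.sum_sub_distrib, ← Finset.sum_mul, hrow, one_mul]
      rfl
    rw [this, ← Finset.add_sum_erase _ _ (Finset.mem_univ x)]
    simp
  have h2 : ∑ y ∈ Finset.univ.erase x, P x y ≤ 1 / 2 := by
    have := Finset.add_sum_erase Finset.univ (fun y => P x y) (Finset.mem_univ x)
    simp only [hrow] at this
    linarith [hlazy x]
  have h3 : ∑ y ∈ Finset.univ.erase x, P x y * (f x - f y) ^ 2 ≤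
      ∑ y, P x y * (f x - f y) ^ 2 :=
    Finset.sum_le_sum_of_subset_of_nonneg (Finset.erase_subset _ _)
      fun y _ _ => mul_nonneg (hnn x y) (sq_nonneg _)
  rw [h1]
  refine (Finset.sum_sq_le_sum_mul_sum_of_sq_le_mul (Finset.univ.erase x)
    (f := fun y => P x y) (g := fun y => P x y * (f x - f y) ^ 2)
    (fun y _ => hnn x y) (fun y _ => mul_nonneg (hnn x y) (sq_nonneg _))
    (fun y _ => le_of_eq (by ring))).trans ?_
  exact mul_le_mul h2 h3 (Finset.sum_nonneg fun y _ => mul_nonneg (hnn x y) (sq_nonneg _))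
    (by norm_num)

/-- One step of a lazy reversible chain lowers the squared `L²(ρ)` norm by at least the
Dirichlet form. -/
theorem sum_sq_mulVec_le [DecidableEq Ω] (hρ : ∀ x, 0 < ρ x) (hnn : ∀ x y, 0 ≤ P x y)
    (hrow : ∀ x, ∑ y, P x y = 1) (hlazy : ∀ x, 1 / 2 ≤ P x x)
    (hrev : ∀ x y, ρ x * P x y = ρ y * P y x) (f : Ω → ℝ) :
    ∑ x, ρ x * P.mulVec f x ^ 2 ≤ ∑ x, ρ x * f x ^ 2 - dirichlet P ρ f := by
  have h1 : ∑ x, ρ x * P.mulVec f x ^ 2 = ∑ x, ρ x * f x ^ 2 +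
      2 * ∑ x, ρ x * (f x * (P.mulVec f x - f x)) +
      ∑ x, ρ x * (P.mulVec f x - f x) ^ 2 := by
    rw [Finset.mul_sum, ← Finset.sum_add_distrib, ← Finset.sum_add_distrib]
    exact Finset.sum_congr rfl fun x _ => by ring
  have h2 : ∑ x, ρ x * (P.mulVec f x - f x) ^ 2 ≤ dirichlet P ρ f := by
    unfold dirichlet
    rw [Finset.mul_sum]
    refine Finset.sum_le_sum fun x _ => ?_
    refine (mul_le_mul_of_nonneg_left (sq_mulVec_sub_self_le hnn hrow hlazy f x)
      (hρ x).le).trans (le_of_eq ?_)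
    simp only [Finset.mul_sum]
    exact Finset.sum_congr rfl fun y _ => by ring
  rw [h1, sum_mul_mulVec_sub_self hrow hrev]
  linarith

/-- The density of the law of the chain at time `t`, started at `H`, relative to `ρ`,
minus `1`. -/
noncomputable def excess [DecidableEq Ω] (P : Matrix Ω Ω ℝ) (ρ : Ω → ℝ) (H : Ω) (t : ℕ)
    (y : Ω) : ℝ :=
  (P ^ t) H y / ρ y - 1

variable [DecidableEq Ω]

theorem sum_pow_row (hrow : ∀ x, ∑ y, P x y = 1) (t : ℕ) (x : Ω) : ∑ y, (P ^ t) x y = 1 := by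
  induction t with
  | zero => simp [Matrix.one_apply]
  | succ t ih =>
    simp only [pow_succ, Matrix.mul_apply]
    rw [Finset.sum_comm]
    simp only [← Finset.mul_sum, hrow, mul_one, ih]

theorem excess_succ (hρ : ∀ x, 0 < ρ x) (hrow : ∀ x, ∑ y, P x y = 1)
    (hrev : ∀ x y, ρ x * P x y = ρ y * P y x) (H : Ω) (t : ℕ) :
    excess P ρ H (t + 1) = P.mulVec (excess P ρ H t) := by
  funext y
  have h : P.mulVec (excess P ρ H t) y = ∑ z, P y z * ((P ^ t) H z / ρ z) - 1 := by
    simp only [Matrix.mulVec, dotProduct, excess, mul_sub, mul_one, Finset.sum_sub_distrib, hrow]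
  rw [h]
  simp only [excess, pow_succ, Matrix.mul_apply, Finset.sum_div]
  congr 1
  refine Finset.sum_congr rfl fun z _ => ?_
  have hz := (hρ z).ne'
  have hy := (hρ y).ne'
  field_simp
  linear_combination (P ^ t) H z * hrev z y

theorem sum_mul_excess (hρ : ∀ x, 0 < ρ x) (hρ1 : ∑ x, ρ x = 1) (hrow : ∀ x, ∑ y, P x y = 1)
    (H : Ω) (t : ℕ) : ∑ y, ρ y * excess P ρ H t y = 0 := by
  have h : ∀ y, ρ y * excess P ρ H t y = (P ^ t) H y - ρ y := by
    intro y
    have := (hρ y).ne'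
    simp only [excess]
    field_simp
  simp only [h, Finset.sum_sub_distrib, sum_pow_row hrow, hρ1, sub_self]

theorem sum_sq_excess_zero (hρ : ∀ x, 0 < ρ x) (hρ1 : ∑ x, ρ x = 1) (H : Ω) :
    ∑ y, ρ y * excess P ρ H 0 y ^ 2 ≤ 1 / ρ H := by
  have h : ∀ y, ρ y * excess P ρ H 0 y ^ 2 = (if H = y then 1 / ρ y - 2 else 0) + ρ y := by
    intro y
    have := (hρ y).ne'
    simp only [excess, pow_zero, Matrix.one_apply]
    split_ifs
    · field_simp
      ring
    · ring
  simp only [h, Finset.sum_add_distrib, hρ1, Finset.sum_ite_eq, Finset.mem_univ, if_true]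
  linarith

theorem sum_sq_excess_le (hρ : ∀ x, 0 < ρ x) (hρ1 : ∑ x, ρ x = 1) (hnn : ∀ x y, 0 ≤ P x y)
    (hrow : ∀ x, ∑ y, P x y = 1) (hlazy : ∀ x, 1 / 2 ≤ P x x)
    (hrev : ∀ x y, ρ x * P x y = ρ y * P y x) {K : ℝ} (hK : 0 < K)
    (hpoin : ∀ f : Ω → ℝ, pairVariance ρ f ≤ K * dirichlet P ρ f) (H : Ω) (t : ℕ) :
    ∑ y, ρ y * excess P ρ H t y ^ 2 ≤ Real.exp (-(t / K)) * (1 / ρ H) := by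
  induction t with
  | zero => simpa using sum_sq_excess_zero (P := P) hρ hρ1 H
  | succ t ih =>
    have h1 := sum_sq_mulVec_le hρ hnn hrow hlazy hrev (excess P ρ H t)
    have h2 := hpoin (excess P ρ H t)
    rw [pairVariance_of_mean_zero hρ1 (sum_mul_excess hρ hρ1 hrow H t)] at h2
    rw [← excess_succ hρ hrow hrev] at h1
    have h0 : 0 ≤ ∑ y, ρ y * excess P ρ H t y ^ 2 :=
      Finset.sum_nonneg fun y _ => mul_nonneg (hρ y).le (sq_nonneg _)
    set A := ∑ y, ρ y * excess P ρ H t y ^ 2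
    have h3 : A / K ≤ dirichlet P ρ (excess P ρ H t) := by
      rw [div_le_iff₀ hK]; linarith
    have h4 : 1 - 1 / K ≤ Real.exp (-(1 / K)) := by
      linarith [Real.add_one_le_exp (-(1 / K))]
    calc _ ≤ (1 - 1 / K) * A := by
          have : (1 - 1 / K) * A = A - A / K := by ring
          linarith
      _ ≤ Real.exp (-(1 / K)) * (Real.exp (-(t / K)) * (1 / ρ H)) :=
          mul_le_mul h4 ih h0 (Real.exp_pos _).le
      _ = _ := by
          rw [← mul_assoc, ← Real.exp_add]
          congr 2
          push_cast
          ring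

theorem tvDist_sq_le (hρ : ∀ x, 0 < ρ x) (hρ1 : ∑ x, ρ x = 1) (H : Ω) (t : ℕ) :
    tvDist (fun y => (P ^ t) H y) ρ ^ 2 ≤ ∑ y, ρ y * excess P ρ H t y ^ 2 := by
  have h1 : ∀ y, |(P ^ t) H y - ρ y| ^ 2 = ρ y * (ρ y * excess P ρ H t y ^ 2) := by
    intro y
    have := (hρ y).ne'
    rw [sq_abs]
    simp only [excess]
    field_simp
  have h2 := Finset.sum_sq_le_sum_mul_sum_of_sq_le_mul Finset.univ
    (r := fun y => |(P ^ t) H y - ρ y|) (f := ρ) (g := fun y => ρ y * excess P ρ H t y ^ 2)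
    (fun y _ => (hρ y).le) (fun y _ => mul_nonneg (hρ y).le (sq_nonneg _)) (fun y _ => (h1 y).le)
  rw [hρ1, one_mul] at h2
  unfold tvDist
  nlinarith [sq_nonneg (∑ y, |(P ^ t) H y - ρ y|)]

/-- A lazy reversible chain with Poincaré constant `K` is within `ε` of stationarity after
`K (log (1 / ρ(H)) + 2 log (1 / ε))` steps. -/
theorem isCloseAt_of_poincare (hρ : ∀ x, 0 < ρ x) (hρ1 : ∑ x, ρ x = 1) (hnn : ∀ x y, 0 ≤ P x y)
    (hrow : ∀ x, ∑ y, P x y = 1) (hlazy : ∀ x, 1 / 2 ≤ P x x)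
    (hrev : ∀ x y, ρ x * P x y = ρ y * P y x) {K : ℝ} (hK : 0 < K)
    (hpoin : ∀ f : Ω → ℝ, pairVariance ρ f ≤ K * dirichlet P ρ f) {ε : ℝ} (hε : 0 < ε) {H : Ω}
    {t : ℕ} (ht : K * (Real.log (1 / ρ H) + 2 * Real.log (1 / ε)) ≤ t) :
    IsCloseAt P ρ ε H t := by
  have h1 := (tvDist_sq_le (P := P) hρ hρ1 H t).trans
    (sum_sq_excess_le hρ hρ1 hnn hrow hlazy hrev hK hpoin H t)
  have h2 : Real.exp (-(t / K)) * (1 / ρ H) ≤ ε ^ 2 := by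
    have hH : 0 < 1 / ρ H := one_div_pos.2 (hρ H)
    rw [← Real.exp_log hH, ← Real.exp_add, ← Real.exp_log (pow_pos hε 2)]
    refine Real.exp_le_exp.2 ?_
    have h3 : Real.log (1 / ρ H) + 2 * Real.log (1 / ε) ≤ t / K := by
      rw [le_div_iff₀ hK]; linarith
    rw [one_div ε, Real.log_inv] at h3
    rw [Real.log_pow]
    push_cast
    linarith
  exact le_of_abs_le (abs_le_of_sq_le_sq (h1.trans h2) hε.le)

end Decay

end FiniteChain

/-! ### Components and dimensions of function spaces -/

namespace SimpleGraph

section Components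

variable {V : Type*} {G : SimpleGraph V}

/-- The functions on the vertices that are constant on every edge in `S`. -/
def constOn (S : Finset G.edgeSet) : Submodule ℝ (V → ℝ) where
  carrier := {f | ∀ e ∈ S, ∀ u ∈ (e : Sym2 V), ∀ v ∈ (e : Sym2 V), f u = f v}
  zero_mem' := by intro e _ u _ v _; rfl
  add_mem' := by
    intro f g hf hg e he u hu v hv
    simp only [Pi.add_apply, hf e he u hu v hv, hg e he u hu v hv]
  smul_mem' := by
    intro c f hf e he u hu v hv
    simp only [Pi.smul_apply, hf e he u hu v hv]

theorem mem_constOn {S : Finset G.edgeSet} {f : V → ℝ} :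
    f ∈ constOn S ↔ ∀ e ∈ S, ∀ u ∈ (e : Sym2 V), ∀ v ∈ (e : Sym2 V), f u = f v :=
  Iff.rfl

theorem spanningOf_adj {S : Finset G.edgeSet} {u v : V} :
    (spanningOf S).Adj u v ↔ ∃ e ∈ S, (e : Sym2 V) = s(u, v) := by
  constructor
  · intro h
    simpa [spanningOf] using (((fromEdgeSet_adj _).1 h).1)
  · rintro ⟨e, he, h⟩
    refine (fromEdgeSet_adj _).2 ⟨⟨e, he, h⟩, ?_⟩
    have : s(u, v) ∈ G.edgeSet := h ▸ e.2
    exact G.ne_of_adj this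

theorem constOn_union [DecidableEq V] (S T : Finset G.edgeSet) : constOn (S ∪ T) = constOn S ⊓ constOn T := by
  ext f
  simp only [Submodule.mem_inf, mem_constOn, Finset.mem_union, or_imp, forall_and]

/-- The vertices incident both with an edge in `T` and with an edge outside `T`. -/
def edgeBoundary (T : Finset G.edgeSet) : Set V :=
  {v | ∃ e ∈ T, ∃ e' ∉ T, v ∈ (e : Sym2 V) ∧ v ∈ (e' : Sym2 V)}

/-- The set of edges that agrees with `A` on `T` and with `B` off `T`. -/
def splice [DecidableEq V] (T A B : Finset G.edgeSet) : Finset G.edgeSet := (A ∩ T) ∪ (B \ T)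

/-- The functions that vanish on `D`. -/
def vanishOn (D : Set V) : Submodule ℝ (V → ℝ) where
  carrier := {f | ∀ v ∈ D, f v = 0}
  zero_mem' := by intro v _; rfl
  add_mem' := by intro f g hf hg v hv; simp [hf v hv, hg v hv]
  smul_mem' := by intro c f hf v hv; simp [hf v hv]

theorem card_le_finrank_vanishOn_add [Fintype V] (D : Set V) :
    Fintype.card V ≤ Module.finrank ℝ (vanishOn D) + D.ncard := by
  classical
  let r : (V → ℝ) →ₗ[ℝ] (D → ℝ) := LinearMap.funLeft ℝ ℝ Subtype.val
  have hker : LinearMap.ker r = vanishOn D := by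
    ext f
    constructor
    · intro hf v hv
      exact congrFun (LinearMap.mem_ker.1 hf) ⟨v, hv⟩
    · intro hf
      exact LinearMap.mem_ker.2 (funext fun v => hf v.1 v.2)
  have h1 := r.finrank_range_add_finrank_ker
  have h2 : Module.finrank ℝ (LinearMap.range r) ≤ D.ncard := by
    refine (Submodule.finrank_le _).trans ?_
    rw [Module.finrank_fintype_fun_eq_card, ← Nat.card_coe_set_eq, Nat.card_eq_fintype_card]
  rw [Module.finrank_fintype_fun_eq_card, hker] at h1
  omega

/-- Once the boundary of `T` is pinned to zero, the edges in `T` and those off `T` constrain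
disjoint sets of vertices. -/
theorem constOn_inf_vanishOn_sup {T A B : Finset G.edgeSet} (hA : A ⊆ T) (hB : Disjoint B T) :
    (constOn A ⊓ vanishOn (edgeBoundary T)) ⊔ (constOn B ⊓ vanishOn (edgeBoundary T)) =
      vanishOn (edgeBoundary T) := by
  classical
  refine le_antisymm (sup_le inf_le_right inf_le_right) fun f hf => ?_
  let U : Set V := {v | ∃ e ∈ T, v ∈ (e : Sym2 V)}
  rw [Submodule.mem_sup]
  refine ⟨Uᶜ.indicator f, ⟨?_, ?_⟩, U.indicator f, ⟨?_, ?_⟩, Set.indicator_compl_add_self U f⟩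
  · intro e he u hu v hv
    have hu' : u ∈ U := ⟨e, hA he, hu⟩
    have hv' : v ∈ U := ⟨e, hA he, hv⟩
    simp [hu', hv']
  · intro v hv
    simp [Set.indicator_apply, hf v hv]
  · -- an endpoint of an edge off `T` that lies in `U` is a boundary vertex, where `f` vanishes
    have key : ∀ e ∈ B, ∀ w ∈ (e : Sym2 V), U.indicator f w = 0 := by
      intro e he w hw
      by_cases hU : w ∈ U
      · obtain ⟨e', he', hw'⟩ := hU
        have : w ∈ edgeBoundary T := ⟨e', he', e, Finset.disjoint_left.1 hB he, hw', hw⟩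
        simp [Set.indicator_apply, hf w this]
      · simp [hU]
    intro e he u hu v hv
    rw [key e he u hu, key e he v hv]
  · intro v hv
    simp [Set.indicator_apply, hf v hv]

variable [Fintype V] [DecidableEq V]

theorem kappa_eq_finrank (S : Finset G.edgeSet) :
    kappa S = Module.finrank ℝ (constOn S) := by
  classical
  have h := card_connectedComponent_eq_finrank_ker_toLin'_lapMatrix (spanningOf S)
  have hk : LinearMap.ker (Matrix.toLin' ((spanningOf S).lapMatrix ℝ)) = constOn S := by
    ext f
    rw [LinearMap.mem_ker, Matrix.toLin'_apply, lapMatrix_mulVec_eq_zero_iff_forall_adj]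
    constructor
    · intro hf e he u hu v hv
      by_cases huv : u = v
      · rw [huv]
      · exact hf u v (spanningOf_adj.2 ⟨e, he, (Sym2.mem_and_mem_iff huv).1 ⟨hu, hv⟩⟩)
    · intro hf u v huv
      obtain ⟨e, he, h⟩ := spanningOf_adj.1 huv
      exact hf e he u (by simp [h]) v (by simp [h])
  rw [hk] at h
  rw [kappa, Nat.card_eq_fintype_card, h]

theorem kappa_le (S : Finset G.edgeSet) : kappa S ≤ Fintype.card V := by
  rw [kappa_eq_finrank, ← Module.finrank_fintype_fun_eq_card ℝ]
  exact Submodule.finrank_le _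

/-- Exchanging the parts of two edge sets off `T` changes the total number of components by at
most the number of boundary vertices of `T`. -/
theorem kappa_add_kappa_le (T A B : Finset G.edgeSet) :
    kappa A + kappa B ≤
      kappa (splice T A B) + kappa (splice T B A) + (edgeBoundary T).ncard := by
  have split : ∀ X Y : Finset G.edgeSet,
      kappa (splice T X Y) =
        Module.finrank ℝ (constOn (X ∩ T) ⊓ constOn (Y \ T) : Submodule ℝ (V → ℝ)) := by
    intro X Y
    rw [kappa_eq_finrank, splice, constOn_union]
  have self : ∀ X : Finset G.edgeSet, splice T X X = X := by
    intro X; ext e; simp only [splice, Finset.mem_union, Finset.mem_inter, Finset.mem_sdiff]; tauto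
  set Z : Submodule ℝ (V → ℝ) := vanishOn (edgeBoundary T) with hZ
  have modular : ∀ X Y : Finset G.edgeSet,
      Module.finrank ℝ Z +
        Module.finrank ℝ (constOn (X ∩ T) ⊓ constOn (Y \ T) ⊓ Z : Submodule ℝ (V → ℝ)) =
      Module.finrank ℝ (constOn (X ∩ T) ⊓ Z : Submodule ℝ (V → ℝ)) +
        Module.finrank ℝ (constOn (Y \ T) ⊓ Z : Submodule ℝ (V → ℝ)) := by
    intro X Y
    have h := Submodule.finrank_sup_add_finrank_inf_eq
      (constOn (X ∩ T) ⊓ Z : Submodule ℝ (V → ℝ)) (constOn (Y \ T) ⊓ Z)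
    rwa [hZ, constOn_inf_vanishOn_sup Finset.inter_subset_right Finset.sdiff_disjoint,
      ← inf_inf_distrib_right, ← hZ] at h
  have submod : ∀ M N : Submodule ℝ (V → ℝ),
      Module.finrank ℝ (M ⊓ N : Submodule ℝ (V → ℝ)) +
        Module.finrank ℝ (M ⊓ Z : Submodule ℝ (V → ℝ)) ≤
      Module.finrank ℝ M + Module.finrank ℝ (M ⊓ N ⊓ Z : Submodule ℝ (V → ℝ)) := by
    intro M N
    have h := Submodule.finrank_sup_add_finrank_inf_eq (M ⊓ N) (M ⊓ Z)
    have h' : Module.finrank ℝ (M ⊓ N ⊔ M ⊓ Z : Submodule ℝ (V → ℝ)) ≤ Module.finrank ℝ M :=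
      Submodule.finrank_mono (sup_le inf_le_left inf_le_left)
    rw [← inf_inf_distrib_left, ← inf_assoc] at h
    omega
  have sub' : ∀ M N : Submodule ℝ (V → ℝ),
      Module.finrank ℝ M + Module.finrank ℝ N ≤
      Module.finrank ℝ (M ⊓ N : Submodule ℝ (V → ℝ)) + Fintype.card V := by
    intro M N
    have h := Submodule.finrank_sup_add_finrank_inf_eq M N
    have h' := Submodule.finrank_le (M ⊔ N)
    rw [Module.finrank_fintype_fun_eq_card] at h'
    omega
  have hA := split A A
  have hB := split B B
  rw [self] at hA hB
  rw [hA, hB, split, split]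
  -- `A` and `B` are bounded above by submodularity against `Z`; of the two exchanged sets,
  -- `splice T B A` is bounded below on `Z`, where dimensions are modular, and `splice T A B` by
  -- codimensions adding up
  have hd := card_le_finrank_vanishOn_add (edgeBoundary T)
  rw [← hZ] at hd
  have h1 := submod (constOn (A ∩ T)) (constOn (A \ T))
  have h2 := submod (constOn (B \ T)) (constOn (B ∩ T))
  rw [inf_comm (constOn (B \ T)) (constOn (B ∩ T))] at h2
  have h3 := modular A A
  have h4 := modular B B
  have h5 := modular B A
  have h6 := sub' (constOn (A ∩ T)) (constOn (B \ T))
  have h7 : Module.finrank ℝ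
      (constOn (B ∩ T) ⊓ constOn (A \ T) ⊓ Z : Submodule ℝ (V → ℝ)) ≤
      Module.finrank ℝ (constOn (B ∩ T) ⊓ constOn (A \ T) : Submodule ℝ (V → ℝ)) :=
    Submodule.finrank_mono inf_le_left
  omega

end Components

end SimpleGraph

namespace SimpleGraph

/-! ### Splicing two edge sets -/

section Splice

variable {V : Type*} [DecidableEq V] {G : SimpleGraph V}

theorem splice_splice (T A B : Finset G.edgeSet) : splice T (splice T A B) (splice T B A) = A := by
  ext e
  simp only [splice, Finset.mem_union, Finset.mem_inter, Finset.mem_sdiff]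
  tauto

theorem card_splice_add_card_splice (T A B : Finset G.edgeSet) :
    (splice T A B).card + (splice T B A).card = A.card + B.card := by
  have h : ∀ X Y : Finset G.edgeSet, (splice T X Y).card = (X ∩ T).card + (Y \ T).card := by
    intro X Y
    exact Finset.card_union_of_disjoint
      (Finset.disjoint_of_subset_left Finset.inter_subset_right Finset.disjoint_sdiff)
  have hA := Finset.card_inter_add_card_sdiff A T
  have hB := Finset.card_inter_add_card_sdiff B T
  rw [h, h]
  omega

/-- Adding one edge `e` to `T` changes the splice at most by flipping `e`. -/
theorem splice_insert (T A B : Finset G.edgeSet) {e : G.edgeSet} (he : e ∉ T) :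
    splice (insert e T) A B = splice T A B ∨
      splice (insert e T) A B = symmDiff (splice T A B) {e} := by
  by_cases h : e ∈ A ↔ e ∈ B
  · left
    ext a
    simp only [splice, Finset.mem_union, Finset.mem_inter, Finset.mem_sdiff, Finset.mem_insert]
    by_cases ha : a = e
    · subst ha; tauto
    · simp [ha]
  · right
    ext a
    simp only [splice, Finset.mem_union, Finset.mem_inter, Finset.mem_sdiff, Finset.mem_insert,
      Finset.mem_symmDiff, Finset.mem_singleton]
    by_cases ha : a = e
    · subst ha; tauto
    · simp [ha]

/-- Splicing both ways is an involution on pairs of edge sets. -/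
def spliceEquiv (T : Finset G.edgeSet) :
    Finset G.edgeSet × Finset G.edgeSet ≃ Finset G.edgeSet × Finset G.edgeSet where
  toFun p := (splice T p.2 p.1, splice T p.1 p.2)
  invFun p := (splice T p.2 p.1, splice T p.1 p.2)
  left_inv p := Prod.ext (splice_splice T p.1 p.2) (splice_splice T p.2 p.1)
  right_inv p := Prod.ext (splice_splice T p.1 p.2) (splice_splice T p.2 p.1)

end Splice

theorem one_le_max_inv {q : ℝ} (hq : 0 < q) : 1 ≤ max q (1 / q) := by
  rcases le_total 1 q with h | h
  · exact le_max_of_le_left h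
  · exact le_max_of_le_right (by rw [le_div_iff₀ hq]; linarith)

theorem pow_le_max_inv_pow_mul {q : ℝ} (hq : 0 < q) {a b l : ℕ} (h1 : a ≤ b + l) (h2 : b ≤ a + l) :
    q ^ a ≤ max q (1 / q) ^ l * q ^ b := by
  rcases le_total 1 q with h | h
  · calc q ^ a ≤ q ^ (l + b) := pow_le_pow_right₀ h (by omega)
      _ = q ^ l * q ^ b := pow_add _ _ _
      _ ≤ _ := by gcongr; exact le_max_left _ _
  · calc q ^ a = (1 / q) ^ l * q ^ (a + l) := by
          rw [one_div, inv_pow, pow_add]; field_simp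
      _ ≤ (1 / q) ^ l * q ^ b :=
          mul_le_mul_of_nonneg_left (pow_le_pow_of_le_one hq.le h h2) (by positivity)
      _ ≤ _ := by gcongr; exact le_max_right _ _

/-! ### Edge orders and linear-width -/

section EdgeOrder

variable {V : Type*} [Fintype V] {G : SimpleGraph V} [DecidableRel G.Adj]

/-- The set of the first `i` edges in the order `σ`. -/
def prefixEdges (σ : Fin G.edgeFinset.card ≃ G.edgeSet) (i : ℕ) : Finset G.edgeSet :=
  {e | (σ.symm e : ℕ) < i}

theorem mem_prefixEdges {σ : Fin G.edgeFinset.card ≃ G.edgeSet} {i : ℕ} {e : G.edgeSet} :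
    e ∈ prefixEdges σ i ↔ (σ.symm e : ℕ) < i := by
  simp [prefixEdges]

/-- The boundary of a prefix consists of dangerous vertices; it is empty for the full prefix, which
is not a position of the order. -/
theorem ncard_edgeBoundary_prefixEdges_le {σ : Fin G.edgeFinset.card ≃ G.edgeSet} {l : ℕ}
    (hσ : ∀ i, (G.dangerous σ i).ncard ≤ l) (i : ℕ) :
    (edgeBoundary (prefixEdges σ i)).ncard ≤ l := by
  by_cases hi : i < G.edgeFinset.card
  · refine (Set.ncard_le_ncard ?_ (Set.toFinite _)).trans (hσ ⟨i, hi⟩)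
    rintro v ⟨e, he, e', he', hv, hv'⟩
    rw [mem_prefixEdges] at he he'
    exact ⟨σ.symm e, σ.symm e', Fin.lt_def.2 he, Fin.le_def.2 (not_lt.1 he'), by simpa using hv,
      by simpa using hv'⟩
  · have : edgeBoundary (prefixEdges σ i) = ∅ := by
      rw [Set.eq_empty_iff_forall_notMem]
      rintro v ⟨e, _, e', he', _⟩
      exact he' (mem_prefixEdges.2 (by omega))
    simp [this]

variable (G)

/-- The infimum in the definition of linear-width is attained, as every order has at most `|V|`
dangerous vertices at each position. -/
theorem exists_order_dangerous_le_linearWidth :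
    ∃ σ : Fin G.edgeFinset.card ≃ G.edgeSet, ∀ i, (G.dangerous σ i).ncard ≤ G.linearWidth := by
  have h : {ℓ : ℕ | ∃ σ : Fin G.edgeFinset.card ≃ G.edgeSet,
      ∀ i, (G.dangerous σ i).ncard ≤ ℓ}.Nonempty := by
    refine ⟨Fintype.card V, (Fintype.equivFinOfCardEq (edgeFinset_card).symm).symm, fun i => ?_⟩
    exact (Set.ncard_le_card _).trans_eq Nat.card_eq_fintype_card
  exact Nat.sInf_mem h

end EdgeOrder

/-! ### The bond flip chain: laziness, detailed balance, Dirichlet form -/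

section RandomCluster

variable {V : Type*} (G : SimpleGraph V) {q μ : ℝ}

theorem rcWeight_pos (hq : 0 < q) (hμ : 0 < μ) (S : Finset G.edgeSet) : 0 < rcWeight q μ S :=
  mul_pos (pow_pos hq _) (pow_pos hμ _)

theorem log_rcWeight (hq : 0 < q) (hμ : 0 < μ) (S : Finset G.edgeSet) :
    Real.log (rcWeight q μ S) = kappa S * Real.log q + S.card * Real.log μ := by
  rw [rcWeight, Real.log_mul (pow_pos hq _).ne' (pow_pos hμ _).ne', Real.log_pow, Real.log_pow]

theorem symmDiff_symmDiff_singleton [DecidableEq V] (X : Finset G.edgeSet) (e : G.edgeSet) :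
    symmDiff (symmDiff X {e}) {e} = X :=
  symmDiff_symmDiff_cancel_right _ _

variable [Fintype V] [DecidableRel G.Adj]

theorem sum_rcWeight_pos (hq : 0 < q) (hμ : 0 < μ) :
    0 < ∑ T : Finset G.edgeSet, rcWeight q μ T :=
  Finset.sum_pos (fun T _ => rcWeight_pos G hq hμ T) ⟨∅, Finset.mem_univ _⟩

theorem rcDist_pos (hq : 0 < q) (hμ : 0 < μ) (S : Finset G.edgeSet) : 0 < G.rcDist q μ S :=
  div_pos (rcWeight_pos G hq hμ S) (sum_rcWeight_pos G hq hμ)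

theorem sum_rcDist (hq : 0 < q) (hμ : 0 < μ) : ∑ S, G.rcDist q μ S = 1 := by
  simp only [rcDist, ← Finset.sum_div]
  exact div_self (sum_rcWeight_pos G hq hμ).ne'

variable [DecidableEq V]

/-- The weight that detailed balance assigns to flipping `e`, up to the factor `1 / (2m)`. -/
noncomputable def flipFlow (q μ : ℝ) (X : Finset G.edgeSet) (e : G.edgeSet) : ℝ :=
  min (G.rcDist q μ X) (G.rcDist q μ (symmDiff X {e}))

theorem flipFlow_symmDiff (X : Finset G.edgeSet) (e : G.edgeSet) :
    G.flipFlow q μ (symmDiff X {e}) e = G.flipFlow q μ X e := by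
  rw [flipFlow, flipFlow, symmDiff_symmDiff_singleton, min_comm]

theorem flipFlow_nonneg (hq : 0 < q) (hμ : 0 < μ) (X : Finset G.edgeSet) (e : G.edgeSet) :
    0 ≤ G.flipFlow q μ X e :=
  le_min (rcDist_pos G hq hμ _).le (rcDist_pos G hq hμ _).le

theorem rcDist_mul_flipProb (hq : 0 < q) (hμ : 0 < μ) (X : Finset G.edgeSet) (e : G.edgeSet) :
    G.rcDist q μ X * G.flipProb q μ X e =
      1 / (2 * (G.edgeFinset.card : ℝ)) * G.flipFlow q μ X e := by
  have h : q ^ ((kappa (symmDiff X {e}) : ℤ) - (kappa X : ℤ)) *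
      μ ^ (((symmDiff X {e}).card : ℤ) - (X.card : ℤ)) =
      G.rcDist q μ (symmDiff X {e}) / G.rcDist q μ X := by
    rw [zpow_sub₀ hq.ne', zpow_sub₀ hμ.ne', rcDist, rcDist, rcWeight, rcWeight,
      div_div_div_cancel_right₀ (sum_rcWeight_pos G hq hμ).ne']
    simp only [zpow_natCast]
    rw [div_mul_div_comm]
  have h2 : G.flipFlow q μ X e =
      G.rcDist q μ X * min 1 (G.rcDist q μ (symmDiff X {e}) / G.rcDist q μ X) := by
    rw [mul_min_of_nonneg _ _ (rcDist_pos G hq hμ X).le, mul_one,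
      mul_div_cancel₀ _ (rcDist_pos G hq hμ X).ne', flipFlow]
  rw [flipProb, h, h2, ← div_div]
  ring

theorem flipProb_nonneg (hq : 0 < q) (hμ : 0 < μ) (X : Finset G.edgeSet) (e : G.edgeSet) :
    0 ≤ G.flipProb q μ X e := by
  unfold flipProb
  have h : 0 ≤ q ^ ((kappa (symmDiff X {e}) : ℤ) - (kappa X : ℤ)) *
      μ ^ (((symmDiff X {e}).card : ℤ) - (X.card : ℤ)) := by positivity
  have := le_min zero_le_one h
  positivity

theorem sum_flipProb_le (X : Finset G.edgeSet) : ∑ e, G.flipProb q μ X e ≤ 1 / 2 := by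
  have h : ∀ e ∈ (Finset.univ : Finset G.edgeSet),
      G.flipProb q μ X e ≤ 1 / (G.edgeFinset.card : ℝ) * (1 / 2) := by
    intro e _
    unfold flipProb
    have h1 := min_le_left 1 (q ^ ((kappa (symmDiff X {e}) : ℤ) - (kappa X : ℤ)) *
      μ ^ (((symmDiff X {e}).card : ℤ) - (X.card : ℤ)))
    refine mul_le_mul_of_nonneg_left ?_ (by positivity)
    linarith
  refine (Finset.sum_le_sum h).trans ?_
  rw [Finset.sum_const, nsmul_eq_mul, Finset.card_univ, ← edgeFinset_card]
  rcases Nat.eq_zero_or_pos G.edgeFinset.card with h0 | h0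
  · rw [h0]; norm_num
  · have : (G.edgeFinset.card : ℝ) ≠ 0 := by positivity
    exact le_of_eq (by field_simp)

theorem bondFlip_nonneg (hq : 0 < q) (hμ : 0 < μ) (X Y : Finset G.edgeSet) :
    0 ≤ G.bondFlip q μ X Y := by
  unfold bondFlip
  have := G.sum_flipProb_le (q := q) (μ := μ) X
  refine add_nonneg (Finset.sum_nonneg fun e _ => ?_) ?_
  · split_ifs
    exacts [G.flipProb_nonneg hq hμ X e, le_rfl]
  · split_ifs
    exacts [by linarith, le_rfl]

theorem half_le_bondFlip_self (hq : 0 < q) (hμ : 0 < μ) (X : Finset G.edgeSet) :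
    1 / 2 ≤ G.bondFlip q μ X X := by
  unfold bondFlip
  have h := G.sum_flipProb_le (q := q) (μ := μ) X
  have h2 : 0 ≤ ∑ e : G.edgeSet, if X = symmDiff X {e} then G.flipProb q μ X e else 0 :=
    Finset.sum_nonneg fun e _ => by
      split_ifs
      exacts [G.flipProb_nonneg hq hμ X e, le_rfl]
  rw [if_pos rfl]
  linarith

theorem sum_bondFlip_mul (X : Finset G.edgeSet) (g : Finset G.edgeSet → ℝ) :
    ∑ Y, G.bondFlip q μ X Y * g Y =
      ∑ e, G.flipProb q μ X e * g (symmDiff X {e}) +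
        (1 - ∑ e, G.flipProb q μ X e) * g X := by
  simp only [bondFlip, add_mul, Finset.sum_add_distrib, Finset.sum_mul, ite_mul, zero_mul]
  rw [Finset.sum_comm]
  simp

theorem bondFlip_row_sum (X : Finset G.edgeSet) : ∑ Y, G.bondFlip q μ X Y = 1 := by
  have := G.sum_bondFlip_mul (q := q) (μ := μ) X (fun _ => 1)
  simpa using this

theorem bondFlip_reversible (hq : 0 < q) (hμ : 0 < μ) (X Y : Finset G.edgeSet) :
    G.rcDist q μ X * G.bondFlip q μ X Y = G.rcDist q μ Y * G.bondFlip q μ Y X := by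
  unfold bondFlip
  rw [mul_add, mul_add, Finset.mul_sum, Finset.mul_sum]
  congr 1
  · refine Finset.sum_congr rfl fun e _ => ?_
    by_cases h : Y = symmDiff X {e}
    · have h' : X = symmDiff Y {e} := by rw [h, symmDiff_symmDiff_singleton]
      rw [if_pos h, if_pos h', rcDist_mul_flipProb G hq hμ, rcDist_mul_flipProb G hq hμ, h,
        flipFlow_symmDiff]
    · have h' : X ≠ symmDiff Y {e} := by
        rintro rfl
        exact h (symmDiff_symmDiff_singleton G Y e).symm
      rw [if_neg h, if_neg h', mul_zero, mul_zero]
  · by_cases h : Y = X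
    · subst h; rfl
    · rw [if_neg h, if_neg (Ne.symm h), mul_zero, mul_zero]

theorem dirichlet_bondFlip (hq : 0 < q) (hμ : 0 < μ) (f : Finset G.edgeSet → ℝ) :
    FiniteChain.dirichlet (G.bondFlip q μ) (G.rcDist q μ) f =
      1 / (4 * (G.edgeFinset.card : ℝ)) *
        ∑ e, ∑ X, G.flipFlow q μ X e * (f X - f (symmDiff X {e})) ^ 2 := by
  have h : ∀ X, ∑ Y, G.rcDist q μ X * G.bondFlip q μ X Y * (f X - f Y) ^ 2 =
      ∑ e, 1 / (2 * (G.edgeFinset.card : ℝ)) *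
        (G.flipFlow q μ X e * (f X - f (symmDiff X {e})) ^ 2) := by
    intro X
    simp only [mul_assoc (G.rcDist q μ X), ← Finset.mul_sum]
    rw [G.sum_bondFlip_mul X (fun Y => (f X - f Y) ^ 2), sub_self, zero_pow two_ne_zero,
      mul_zero, add_zero, Finset.mul_sum, Finset.mul_sum]
    refine Finset.sum_congr rfl fun e _ => ?_
    rw [← mul_assoc, rcDist_mul_flipProb G hq hμ, mul_assoc]
  unfold FiniteChain.dirichlet
  simp only [h]
  rw [Finset.sum_comm]
  simp only [← Finset.mul_sum]
  rw [← mul_assoc]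
  congr 1
  ring

/-! ### Canonical paths -/

variable {G}

theorem rcDist_mul_rcDist_le (hq : 0 < q) (hμ : 0 < μ) {T : Finset G.edgeSet} {l : ℕ}
    (hT : (edgeBoundary T).ncard ≤ l) (A B : Finset G.edgeSet) :
    G.rcDist q μ A * G.rcDist q μ B ≤
      max q (1 / q) ^ l * (G.rcDist q μ (splice T B A) * G.rcDist q μ (splice T A B)) := by
  have h1 := kappa_add_kappa_le T A B
  have h2 := kappa_add_kappa_le T (splice T A B) (splice T B A)
  rw [splice_splice, splice_splice] at h2
  have h3 := card_splice_add_card_splice T A B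
  have h4 := pow_le_max_inv_pow_mul hq (l := l) (a := kappa A + kappa B)
    (b := kappa (splice T A B) + kappa (splice T B A)) (by omega) (by omega)
  have hw : rcWeight q μ A * rcWeight q μ B ≤
      max q (1 / q) ^ l * (rcWeight q μ (splice T B A) * rcWeight q μ (splice T A B)) := by
    calc rcWeight q μ A * rcWeight q μ B
        = q ^ (kappa A + kappa B) * μ ^ (A.card + B.card) := by
          simp only [rcWeight, pow_add]; ring
      _ ≤ (max q (1 / q) ^ l * q ^ (kappa (splice T A B) + kappa (splice T B A))) *
            μ ^ (A.card + B.card) := by gcongr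
      _ = _ := by
          rw [← h3]
          simp only [rcWeight, pow_add]; ring
  have hZ := sum_rcWeight_pos G hq hμ
  simp only [rcDist]
  rw [div_mul_div_comm, div_mul_div_comm, ← mul_div_assoc]
  gcongr

/-- One step of the canonical path from `I` to `F`. The pair `(I, F)` is charged to the smaller of
the two states of the step, together with the complementary splice. -/
theorem rcDist_mul_path_step_le (hq : 0 < q) (hμ : 0 < μ) {T : Finset G.edgeSet} {e : G.edgeSet}
    (he : e ∉ T) {l : ℕ} (hT : (edgeBoundary T).ncard ≤ l)
    (hT' : (edgeBoundary (insert e T)).ncard ≤ l) (f : Finset G.edgeSet → ℝ)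
    (I F : Finset G.edgeSet) :
    G.rcDist q μ I * G.rcDist q μ F * (f (splice T F I) - f (splice (insert e T) F I)) ^ 2 ≤
      max q (1 / q) ^ l *
        (G.flipFlow q μ (splice T F I) e *
            (f (splice T F I) - f (symmDiff (splice T F I) {e})) ^ 2 *
            G.rcDist q μ (splice T I F) +
          G.flipFlow q μ (splice (insert e T) F I) e *
            (f (splice (insert e T) F I) - f (symmDiff (splice (insert e T) F I) {e})) ^ 2 *
            G.rcDist q μ (splice (insert e T) I F)) := by
  have hQ : 0 ≤ max q (1 / q) ^ l := pow_nonneg (zero_le_one.trans (one_le_max_inv hq)) _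
  have n1 := mul_nonneg (mul_nonneg (G.flipFlow_nonneg hq hμ (splice T F I) e)
    (sq_nonneg (f (splice T F I) - f (symmDiff (splice T F I) {e}))))
    (G.rcDist_pos hq hμ (splice T I F)).le
  have n2 := mul_nonneg (mul_nonneg (G.flipFlow_nonneg hq hμ (splice (insert e T) F I) e)
    (sq_nonneg (f (splice (insert e T) F I) - f (symmDiff (splice (insert e T) F I) {e}))))
    (G.rcDist_pos hq hμ (splice (insert e T) I F)).le
  -- if `I` and `F` agree at `e`, the path does not move and the left side vanishes
  rcases splice_insert T F I he with h | h
  · rw [h, sub_self, zero_pow two_ne_zero, mul_zero]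
    rw [h] at n2
    exact mul_nonneg hQ (add_nonneg n1 n2)
  · have b1 := rcDist_mul_rcDist_le hq hμ hT I F
    have b2 := rcDist_mul_rcDist_le hq hμ hT' I F
    rw [h] at b2 n2 ⊢
    rw [symmDiff_symmDiff_singleton, flipFlow_symmDiff] at n2 ⊢
    set X := splice T F I
    set Y := symmDiff X {e} with hY
    rcases le_total (G.rcDist q μ X) (G.rcDist q μ Y) with hXY | hXY
    · have hf : G.flipFlow q μ X e = G.rcDist q μ X := min_eq_left hXY
      rw [hf] at n2 ⊢
      have := mul_le_mul_of_nonneg_right b1 (sq_nonneg (f X - f Y))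
      have := mul_nonneg hQ n2
      linarith
    · have hf : G.flipFlow q μ X e = G.rcDist q μ Y := min_eq_right hXY
      rw [hf] at n1 ⊢
      have := mul_le_mul_of_nonneg_right b2 (sq_nonneg (f X - f Y))
      have := mul_nonneg hQ n1
      linarith

theorem sum_splice_eq (hq : 0 < q) (hμ : 0 < μ) (T : Finset G.edgeSet)
    (g : Finset G.edgeSet → ℝ) :
    ∑ I, ∑ F, g (splice T F I) * G.rcDist q μ (splice T I F) = ∑ X, g X := by
  rw [← Fintype.sum_prod_type']
  refine ((spliceEquiv T).sum_comp (fun p => g p.1 * G.rcDist q μ p.2)).trans ?_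
  rw [Fintype.sum_prod_type]
  simp only [← Finset.mul_sum, sum_rcDist G hq hμ, mul_one]

/-- The total charge of the canonical path steps across one edge. -/
theorem sum_path_step_le (hq : 0 < q) (hμ : 0 < μ) {T : Finset G.edgeSet} {e : G.edgeSet}
    (he : e ∉ T) {l : ℕ} (hT : (edgeBoundary T).ncard ≤ l)
    (hT' : (edgeBoundary (insert e T)).ncard ≤ l) (f : Finset G.edgeSet → ℝ) :
    ∑ I, ∑ F, G.rcDist q μ I * G.rcDist q μ F *
        (f (splice T F I) - f (splice (insert e T) F I)) ^ 2 ≤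
      2 * max q (1 / q) ^ l *
        ∑ X, G.flipFlow q μ X e * (f X - f (symmDiff X {e})) ^ 2 := by
  refine (Finset.sum_le_sum fun I _ => Finset.sum_le_sum fun F _ =>
    rcDist_mul_path_step_le hq hμ he hT hT' f I F).trans (le_of_eq ?_)
  simp only [← Finset.mul_sum, Finset.sum_add_distrib]
  rw [sum_splice_eq hq hμ T (fun X => G.flipFlow q μ X e * (f X - f (symmDiff X {e})) ^ 2),
    sum_splice_eq hq hμ (insert e T)
      (fun X => G.flipFlow q μ X e * (f X - f (symmDiff X {e})) ^ 2)]
  ring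

theorem prefixEdges_succ (σ : Fin G.edgeFinset.card ≃ G.edgeSet) (i : Fin G.edgeFinset.card) :
    prefixEdges σ (i + 1) = insert (σ i) (prefixEdges σ i) := by
  ext e
  rw [Finset.mem_insert, mem_prefixEdges, mem_prefixEdges, ← Equiv.symm_apply_eq,
    Nat.lt_succ_iff_lt_or_eq, Fin.ext_iff]
  tauto

/-- The Poincaré inequality of the single bond flip chain. -/
theorem pairVariance_le_dirichlet (hq : 0 < q) (hμ : 0 < μ)
    {σ : Fin G.edgeFinset.card ≃ G.edgeSet} {l : ℕ}
    (hσ : ∀ i, (G.dangerous σ i).ncard ≤ l) (hm : 0 < G.edgeFinset.card)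
    (f : Finset G.edgeSet → ℝ) :
    FiniteChain.pairVariance (G.rcDist q μ) f ≤
      4 * (G.edgeFinset.card : ℝ) ^ 2 * max q (1 / q) ^ l *
        FiniteChain.dirichlet (G.bondFlip q μ) (G.rcDist q μ) f := by
  have hm' : (G.edgeFinset.card : ℝ) ≠ 0 := by positivity
  let D : Finset G.edgeSet → Finset G.edgeSet → Fin G.edgeFinset.card → ℝ := fun I F i =>
    f (splice (prefixEdges σ i) F I) - f (splice (insert (σ i) (prefixEdges σ i)) F I)
  -- Cauchy–Schwarz along the path, which has `m` steps
  have tele : ∀ I F, (f I - f F) ^ 2 ≤ G.edgeFinset.card * ∑ i, D I F i ^ 2 := by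
    intro I F
    have h0 : splice (prefixEdges σ 0) F I = I := by
      ext e; simp [splice, mem_prefixEdges]
    have h1 : splice (prefixEdges σ G.edgeFinset.card) F I = F := by
      ext e; simp [splice, mem_prefixEdges]
    have h2 : f I - f F = ∑ i, D I F i := by
      have h := Finset.sum_range_sub' (fun i => f (splice (prefixEdges σ i) F I))
        G.edgeFinset.card
      rw [h0, h1, Finset.sum_range] at h
      rw [← h]
      exact Finset.sum_congr rfl fun i _ => by rw [prefixEdges_succ]
    rw [h2]
    simpa using sq_sum_le_card_mul_sum_sq (s := Finset.univ) (f := D I F)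
  have hsum : ∑ I, ∑ F, G.rcDist q μ I * G.rcDist q μ F * (f I - f F) ^ 2 ≤
      G.edgeFinset.card * ∑ i, ∑ I, ∑ F, G.rcDist q μ I * G.rcDist q μ F * D I F i ^ 2 := by
    calc _ ≤ ∑ I, ∑ F, G.rcDist q μ I * G.rcDist q μ F * (G.edgeFinset.card * ∑ i, D I F i ^ 2) :=
          Finset.sum_le_sum fun I _ => Finset.sum_le_sum fun F _ =>
            mul_le_mul_of_nonneg_left (tele I F)
              (mul_pos (G.rcDist_pos hq hμ I) (G.rcDist_pos hq hμ F)).le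
      _ = ∑ I, ∑ F, ∑ i, G.edgeFinset.card * (G.rcDist q μ I * G.rcDist q μ F * D I F i ^ 2) := by
          refine Finset.sum_congr rfl fun I _ => Finset.sum_congr rfl fun F _ => ?_
          rw [Finset.mul_sum, Finset.mul_sum]
          exact Finset.sum_congr rfl fun i _ => by ring
      _ = _ := by
          rw [Finset.sum_congr rfl fun I _ => Finset.sum_comm, Finset.sum_comm]
          simp only [Finset.mul_sum]
  have hstep : ∀ i, ∑ I, ∑ F, G.rcDist q μ I * G.rcDist q μ F * D I F i ^ 2 ≤
      2 * max q (1 / q) ^ l *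
        ∑ X, G.flipFlow q μ X (σ i) * (f X - f (symmDiff X {σ i})) ^ 2 := by
    intro i
    have he : σ i ∉ prefixEdges σ i := by simp [mem_prefixEdges]
    have h1 := ncard_edgeBoundary_prefixEdges_le hσ (i + 1)
    rw [prefixEdges_succ] at h1
    exact sum_path_step_le hq hμ he (ncard_edgeBoundary_prefixEdges_le hσ i) h1 f
  have hall := Finset.sum_le_sum fun i (_ : i ∈ Finset.univ) => hstep i
  rw [← Finset.mul_sum,
    σ.sum_comp (fun e => ∑ X, G.flipFlow q μ X e * (f X - f (symmDiff X {e})) ^ 2)] at hall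
  rw [dirichlet_bondFlip G hq hμ, FiniteChain.pairVariance]
  have hfin := hsum.trans (mul_le_mul_of_nonneg_left hall (Nat.cast_nonneg _))
  generalize ∑ e, ∑ X, G.flipFlow q μ X e * (f X - f (symmDiff X {e})) ^ 2 = E at hfin ⊢
  refine (mul_le_mul_of_nonneg_left hfin (by norm_num)).trans (le_of_eq ?_)
  field_simp

/-! ### The least probability of a state -/

theorem sub_mul_le_mul_abs {a b c : ℕ} (ha : a ≤ c) (hb : b ≤ c) (x : ℝ) :
    ((a : ℝ) - b) * x ≤ c * |x| := by
  have ha' : (a : ℝ) ≤ c := by exact_mod_cast ha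
  have hb' : (b : ℝ) ≤ c := by exact_mod_cast hb
  refine (le_abs_self _).trans ?_
  rw [abs_mul]
  refine mul_le_mul_of_nonneg_right (abs_le.2 ⟨?_, ?_⟩) (abs_nonneg _) <;>
    linarith [Nat.cast_nonneg (α := ℝ) a, Nat.cast_nonneg (α := ℝ) b]

theorem log_one_div_rcDist_le (hq : 0 < q) (hμ : 0 < μ) (H : Finset G.edgeSet) :
    Real.log (1 / G.rcDist q μ H) ≤ G.edgeFinset.card + Fintype.card V * |Real.log q| +
      G.edgeFinset.card * |Real.log μ| := by
  set m := G.edgeFinset.card with hmdef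
  set L := Fintype.card V * |Real.log q| + m * |Real.log μ| with hL
  have hcard : Fintype.card G.edgeSet = m := by rw [hmdef, edgeFinset_card]
  have h1 : ∀ T : Finset G.edgeSet, rcWeight q μ T ≤ Real.exp L * rcWeight q μ H := by
    intro T
    rw [← Real.exp_log (rcWeight_pos G hq hμ T), ← Real.exp_log (rcWeight_pos G hq hμ H),
      ← Real.exp_add, Real.exp_le_exp, log_rcWeight G hq hμ, log_rcWeight G hq hμ]
    have hc : ∀ S : Finset G.edgeSet, S.card ≤ m := fun S => hcard ▸ Finset.card_le_univ S
    have a1 := sub_mul_le_mul_abs (kappa_le T) (kappa_le H) (Real.log q)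
    have a2 := sub_mul_le_mul_abs (hc T) (hc H) (Real.log μ)
    linarith
  have h2 : ∑ T : Finset G.edgeSet, rcWeight q μ T ≤ 2 ^ m * (Real.exp L * rcWeight q μ H) := by
    refine (Finset.sum_le_sum fun T _ => h1 T).trans (le_of_eq ?_)
    rw [Finset.sum_const, nsmul_eq_mul, Finset.card_univ, Fintype.card_finset, hcard]
    push_cast
    rfl
  have h3 : (2 : ℝ) ^ m ≤ Real.exp m := by
    rw [← mul_one (m : ℝ), Real.exp_nat_mul]
    exact pow_le_pow_left₀ (by norm_num) (by linarith [Real.add_one_le_exp (1 : ℝ)]) _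
  have hH := rcWeight_pos G hq hμ H
  have h4 : 1 / G.rcDist q μ H ≤ Real.exp (m + L) := by
    rw [rcDist, one_div_div, div_le_iff₀ hH, Real.exp_add, mul_assoc]
    exact h2.trans (mul_le_mul_of_nonneg_right h3 (mul_pos (Real.exp_pos _) hH).le)
  have h5 := Real.log_le_log (one_div_pos.2 (G.rcDist_pos hq hμ H)) h4
  rw [Real.log_exp] at h5
  linarith

/-! ### The mixing time -/

variable (G)

theorem isCloseAt_bondFlip (hq : 0 < q) (hμ : 0 < μ) {ε : ℝ} (hε : 0 < ε)
    (hm : 0 < G.edgeFinset.card) (H : Finset G.edgeSet) {t : ℕ}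
    (ht : 4 * (G.edgeFinset.card : ℝ) ^ 2 * max q (1 / q) ^ G.linearWidth *
      (G.edgeFinset.card + Fintype.card V * |Real.log q| +
      G.edgeFinset.card * |Real.log μ| + 2 * Real.log (1 / ε)) ≤ t) :
    FiniteChain.IsCloseAt (G.bondFlip q μ) (G.rcDist q μ) ε H t := by
  obtain ⟨σ, hσ⟩ := G.exists_order_dangerous_le_linearWidth
  have hK : 0 < 4 * (G.edgeFinset.card : ℝ) ^ 2 * max q (1 / q) ^ G.linearWidth := by
    have := zero_lt_one.trans_le (one_le_max_inv hq)
    positivity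
  refine FiniteChain.isCloseAt_of_poincare (G.rcDist_pos hq hμ) (G.sum_rcDist hq hμ)
    (G.bondFlip_nonneg hq hμ) G.bondFlip_row_sum (G.half_le_bondFlip_self hq hμ)
    (G.bondFlip_reversible hq hμ) hK (pairVariance_le_dirichlet hq hμ hσ hm) hε ?_
  refine (mul_le_mul_of_nonneg_left ?_ hK.le).trans ht
  linarith [log_one_div_rcDist_le hq hμ H]

/-- Without edges there is a single state, so the chain is stationary from the start. -/
theorem isCloseAt_zero_of_card_eq_zero (hq : 0 < q) (hμ : 0 < μ) {ε : ℝ} (hε : 0 < ε)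
    (hm : G.edgeFinset.card = 0) (H : Finset G.edgeSet) :
    FiniteChain.IsCloseAt (G.bondFlip q μ) (G.rcDist q μ) ε H 0 := by
  have hE : IsEmpty G.edgeSet := Fintype.card_eq_zero_iff.1 (by rw [← edgeFinset_card, hm])
  have h1 := G.sum_rcDist hq hμ
  rw [Fintype.sum_unique] at h1
  rw [FiniteChain.IsCloseAt, FiniteChain.tvDist, Fintype.sum_unique, h1,
    Subsingleton.elim H default]
  simpa using hε.le

end RandomCluster

end SimpleGraph

theorem mainTheorem5 :
    ∃ C : ℝ, 0 < C ∧
      ∀ (V : Type*) [Fintype V] [DecidableEq V] (G : SimpleGraph V) [DecidableRel G.Adj]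
        (q μ ε : ℝ), 0 < q → 0 < μ → 0 < ε → ε ≤ 1 →
        (∀ H : Finset G.edgeSet, ∃ t : ℕ,
          FiniteChain.IsCloseAt (G.bondFlip q μ) (G.rcDist q μ) ε H t) ∧
        (FiniteChain.mixingTime (G.bondFlip q μ) (G.rcDist q μ) ε : ℝ) ≤
          C * ((G.edgeFinset.card : ℝ) ^ 2 * (max q (1 / q)) ^ G.linearWidth *
            ((G.edgeFinset.card : ℝ) + (Fintype.card V : ℝ) * |Real.log q| +
              (G.edgeFinset.card : ℝ) * |Real.log μ| + Real.log (1 / ε))) := by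
  -- `8 = 4 · 2`: the Poincaré constant, times the factor that covers `2 log (1 / ε)`; one more
  -- absorbs the rounding up to an integer time
  refine ⟨9, by norm_num, ?_⟩
  intro V _ _ G _ q μ ε hq hμ hε hε1
  set m := G.edgeFinset.card with hmdef
  set R := (m : ℝ) + Fintype.card V * |Real.log q| + m * |Real.log μ| + Real.log (1 / ε) with hR
  set A := (m : ℝ) ^ 2 * max q (1 / q) ^ G.linearWidth with hA
  have hQ : 1 ≤ max q (1 / q) ^ G.linearWidth := one_le_pow₀ (SimpleGraph.one_le_max_inv hq)
  have hlog : 0 ≤ Real.log (1 / ε) := Real.log_nonneg (by rw [le_div_iff₀ hε]; linarith)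
  have hRm : (m : ℝ) ≤ R := by
    have : 0 ≤ (Fintype.card V : ℝ) * |Real.log q| + m * |Real.log μ| := by positivity
    linarith
  suffices h : ∃ t : ℕ, (∀ H, FiniteChain.IsCloseAt (G.bondFlip q μ) (G.rcDist q μ) ε H t) ∧
      (t : ℝ) ≤ 9 * (A * R) by
    obtain ⟨t, ht, htle⟩ := h
    refine ⟨fun H => ⟨t, ht H⟩, le_trans ?_ htle⟩
    exact_mod_cast Finset.sup_le fun H _ => Nat.sInf_le (ht H)
  rcases Nat.eq_zero_or_pos m with hm | hm
  · exact ⟨0, fun H => G.isCloseAt_zero_of_card_eq_zero hq hμ hε hm H, by simp [hA, hm]⟩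
  · have hm1 : (1 : ℝ) ≤ m := by exact_mod_cast hm
    have hA1 : 1 ≤ A := one_le_mul_of_one_le_of_one_le (one_le_pow₀ hm1) hQ
    have hAR : 1 ≤ A * R := one_le_mul_of_one_le_of_one_le hA1 (hm1.trans hRm)
    refine ⟨⌈8 * (A * R)⌉₊, fun H => ?_, ?_⟩
    · refine G.isCloseAt_bondFlip hq hμ hε hm H (le_trans ?_ (Nat.le_ceil _))
      have h1 : 4 * (m : ℝ) ^ 2 * max q (1 / q) ^ G.linearWidth = 4 * A := by rw [hA]; ring
      rw [← hmdef, h1]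
      have h2 : (m : ℝ) + Fintype.card V * |Real.log q| + m * |Real.log μ| +
          2 * Real.log (1 / ε) ≤ 2 * R := by
        have : 0 ≤ (Fintype.card V : ℝ) * |Real.log q| + m * |Real.log μ| := by positivity
        linarith
      calc _ ≤ 4 * A * (2 * R) := mul_le_mul_of_nonneg_left h2 (by linarith)
        _ = _ := by ring
    · have := (Nat.ceil_lt_add_one (show 0 ≤ 8 * (A * R) by linarith)).le
      linarith
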